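/- Let $a,b,r:[0,\infty)\to\mathbb R$, $c:[0,\infty)^2\to\mathbb R$ and $d>0$, and put \[ w_{t,s}=a(s)+\frac{b(s)}{t+d}+c_{t,s}\qquad (0\le s\le t,\ t>0). \] Call a nonnegative function $h$ on $[0,\infty)$ directly Riemann integrable if it is Riemann integrable on every finite interval and $\sum_{n=1}^\infty \sup_{n\tau\le\theta\le(n+1)\tau}h(\theta)<\infty$ for every $\tau>0$. Assume that $w_{t,s}\ge 0$ and that the following conditions hold. 1. $a\in L^1[0,\infty)$, $a\ge 0$ almost everywhere, and $\int_0^\infty a(s)\,ds=1$. 2. $b\in L^1[0,\infty)$. 3. $r\in L^1[0,\infty)$ is nonnegative and continuous. 4. $c$ is jointly measurable, $s\mapsto c_{t,s}$ is integrable on $[0,t]$ for every $t>0$, and $\lim_{t\to\infty}c_{t,s}=0$ for almost every $s>0$. 5. There is a $z>1$ such that $\int_0^\infty a(t)z^t\,dt<\infty$, $\int_0^\infty|b(t)|z^t\,dt<\infty$, and the functions $t\mapsto z^t\int_0^t|c_{t,s}|\,ds$ and $t\mapsto r(t)z^t$ are directly Riemann integrable on $[0,\infty)$. Let $g:[0,\infty)\to\mathbb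 R$ satisfy $g(0)=1$ and \[ g(t)=\int_0^t w_{t,s}\,g(t-s)\,ds+r(t)\qquad\text{for all } t>0, \] suppose that for every $T>0$ there is $t>T$ with $g(t)>0$, and suppose that $g$ is decreasing (that is, non-increasing). Put \[ \gamma=\frac{\int_0^\infty b(s)\,ds}{\int_0^\infty s\,a(s)\,ds}. \] Then there is a constant $C$ with $0<C<\infty$ such that $g(t)\,t^{-\gamma}\to C$ as $t\to\infty$. -/

import Mathlib

/-- Riemann (Darboux) integrability of `h` on `[α, β]`: `h` is bounded there, and the upper and
lower Darboux sums over a suitable partition `α = p 0 ≤ p 1 ≤ ⋯ ≤ p n = β` differ by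
arbitrarily little. -/
def RiemannIntegrableOn (h : ℝ → ℝ) (α β : ℝ) : Prop :=
  BddAbove (h '' Set.Icc α β) ∧ BddBelow (h '' Set.Icc α β) ∧
    ∀ ε : ℝ, 0 < ε → ∃ (n : ℕ) (p : ℕ → ℝ), Monotone p ∧ p 0 = α ∧ p n = β ∧
      ∑ i ∈ Finset.range n,
        (sSup (h '' Set.Icc (p i) (p (i + 1))) - sInf (h '' Set.Icc (p i) (p (i + 1)))) *
          (p (i + 1) - p i) < ε

/-- Direct Riemann integrability on `[0, ∞)` of a function that is nonnegative there: Riemann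
integrability on every finite interval, and for every span `τ > 0` convergence of
`∑_{n ≥ 1} sup_{n τ ≤ θ ≤ (n + 1) τ} h θ`. -/
def DirectlyRiemannIntegrable (h : ℝ → ℝ) : Prop :=
  (∀ t : ℝ, 0 ≤ t → 0 ≤ h t) ∧
  (∀ T : ℝ, 0 < T → RiemannIntegrableOn h 0 T) ∧
  ∀ τ : ℝ, 0 < τ →
    Summable fun n : ℕ =>
      sSup (h '' Set.Icc (((n : ℝ) + 1) * τ) (((n : ℝ) + 2) * τ))

/-- The kernel `w_{t,s} = a(s) + b(s) / (t + d) + c_{t,s}`. -/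
noncomputable def volterraKernel (a b : ℝ → ℝ) (c : ℝ → ℝ → ℝ) (d t s : ℝ) : ℝ :=
  a s + b s / (t + d) + c t s

/-! Extend `g` by zero to a function f and put η = log z. Direct Riemann integrability is used only
through boundedness: it makes ∫₀ᵗ|c_{t,s}| ds and r(t) of order e^{-ηt}, so the kernel has mass 1 +
O(1/t).

Monotonicity gives regularity. As r ≥ 0, f(t) ≥ ∫ w f(t-s) ds, whence ∫ w (f(t-s) - f(t)) ds =
O(f(t)/t) with a nonnegative integrand. Fixing δ with ∫_δ^∞ a ≥ 1/2 yields f(t-δ) ≤ f(t)(1 + K/t)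
(`sub_mul_integral_le`). Iteration bounds every shift, with a constant subexponential in the shift
(`slowlyVaryingUnderShifts_of_step`). So f decays more slowly than any exponential, the terms in c
and r are O(f(t)/t²), and f - a*f = B f(t)/t + O(f(t)/t²) with B = ∫ b (`abs_renewalDefect_sub_le`).

No derivative of f is available, so f is replaced by M(t) = ∫ a(s) ∫_{t-s}^t f. This is a primitive
of f - a*f (`delayedMass_sub`), and M = μf + O(f/t) with μ = ∫ s a(s) ds. Hence M(T) - M(S) = γ
(T-S)/S · M(S) + O(M(S)/S²) over steps of length at most one; log M(t) - γ log t has summable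
increments and converges (`exists_tendsto_mul_rpow`). -/

open MeasureTheory Set Filter Topology

/-! ### Boundedness, exponential inequalities and a convergence criterion -/

/-- A directly Riemann integrable function is bounded on the half-line. -/
theorem DirectlyRiemannIntegrable.exists_le {h : ℝ → ℝ} (hh : DirectlyRiemannIntegrable h) :
    ∃ K : ℝ, 0 < K ∧ ∀ t : ℝ, 0 ≤ t → h t ≤ K := by
  obtain ⟨h0, hR, hs⟩ := hh
  obtain ⟨K₁, hK₁⟩ := (hR 1 one_pos).1
  have hs1 := hs 1 one_pos
  set S : ℕ → ℝ := fun n => sSup (h '' Icc (((n : ℝ) + 1) * 1) (((n : ℝ) + 2) * 1)) with hS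
  have hSn : ∀ n, 0 ≤ S n := fun n => by
    apply Real.sSup_nonneg
    rintro _ ⟨x, hx, rfl⟩
    refine h0 x (le_trans ?_ hx.1)
    positivity
  refine ⟨max K₁ (∑' n, S n) + 1, ?_, fun t ht => ?_⟩
  · have : 0 ≤ ∑' n, S n := tsum_nonneg hSn
    have := le_max_right K₁ (∑' n, S n)
    linarith
  -- The series starts at the interval [1, 2], so [0, 1] is covered by Riemann integrability.
  · rcases le_total t 1 with h1 | h1
    · have := hK₁ ⟨t, ⟨ht, h1⟩, rfl⟩
      have := le_max_left K₁ (∑' n, S n)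
      linarith
    · set n := ⌊t - 1⌋₊ with hn
      have hn1 : (n : ℝ) ≤ t - 1 := Nat.floor_le (by linarith)
      have hn2 : t - 1 < n + 1 := Nat.lt_floor_add_one _
      -- Needed separately: `sSup` of an unbounded set is 0, so the series alone bounds nothing.
      have hb : BddAbove (h '' Icc (((n : ℝ) + 1) * 1) (((n : ℝ) + 2) * 1)) := by
        refine (hR ((n : ℝ) + 2) (by positivity)).1.mono (image_mono ?_)
        intro x hx
        refine ⟨le_trans (by positivity) hx.1, by simpa using hx.2⟩
      have h2 : h t ≤ S n := le_csSup hb ⟨t, ⟨by linarith, by linarith⟩, rfl⟩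
      have h3 : S n ≤ ∑' n, S n := hs1.le_tsum n fun j _ => hSn j
      have := le_max_right K₁ (∑' n, S n)
      linarith

theorem le_exp_mul_div {η : ℝ} (hη : 0 < η) (x : ℝ) : x ≤ Real.exp (η * x) / η := by
  rw [le_div_iff₀ hη]
  linarith [Real.add_one_le_exp (η * x)]

theorem exp_neg_le_div {η t : ℝ} (hη : 0 < η) (ht : 0 < t) :
    Real.exp (-(η * t)) ≤ 1 / η / t := by
  rw [Real.exp_neg, div_div, one_div]
  apply inv_anti₀ (by positivity)
  linarith [Real.add_one_le_exp (η * t)]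

theorem exp_neg_le_div_sq {η t : ℝ} (hη : 0 < η) (ht : 0 < t) :
    Real.exp (-(η * t)) ≤ 2 / η ^ 2 / t ^ 2 := by
  have h1 : 0 < η * t := by positivity
  have h := Real.quadratic_le_exp_of_nonneg h1.le
  have h2 : (2 / η ^ 2 / t ^ 2 : ℝ) = ((η * t) ^ 2 / 2)⁻¹ := by field_simp
  rw [Real.exp_neg, h2]
  apply inv_anti₀ (by positivity)
  linarith

/-- If the increments of `L` over steps of length at most one from `S` are `O(S⁻²)`, then `L`
converges at infinity. -/
theorem exists_tendsto_of_increment_le {L : ℝ → ℝ} {K T₀ : ℝ} (hK : 0 ≤ K) (hT₀ : 1 < T₀)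
    (h : ∀ S, T₀ ≤ S → ∀ T, S ≤ T → T ≤ S + 1 → |L T - L S| ≤ K / S ^ 2) :
    ∃ l, Tendsto L atTop (𝓝 l) := by
  -- K/S² is dominated by a telescoping difference, which sums the unit steps.
  have step : ∀ S, T₀ ≤ S → K / S ^ 2 ≤ K / (S - 1) - K / S := fun S hS => by
    have h1 : 0 < S - 1 := by linarith
    have h2 : 0 < S := by linarith
    rw [div_sub_div _ _ h1.ne' h2.ne', div_le_div_iff₀ (by positivity) (by positivity)]
    nlinarith [mul_nonneg hK h2.le]
  have chain : ∀ S, T₀ ≤ S → ∀ n : ℕ, |L (S + n) - L S| ≤ K / (S - 1) - K / (S + n - 1) := by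
    intro S hS n
    induction n with
    | zero => simp
    | succ n ih =>
      have hn : (0 : ℝ) ≤ n := n.cast_nonneg
      have h1 := h (S + n) (by linarith) (S + n + 1) (by linarith) le_rfl
      have h2 := step (S + n) (by linarith)
      have h3 := abs_sub_le (L (S + n + 1)) (L (S + n)) (L S)
      push_cast
      rw [show S + ((n : ℝ) + 1) = S + n + 1 by ring, show S + (n : ℝ) + 1 - 1 = S + n by ring]
      linarith
  have bound : ∀ S, T₀ ≤ S → ∀ T, S ≤ T → |L T - L S| ≤ K / (S - 1) := by
    intro S hS T hT
    set n := ⌊T - S⌋₊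
    have hn : (0 : ℝ) ≤ n := n.cast_nonneg
    have hn1 : (n : ℝ) ≤ T - S := Nat.floor_le (by linarith)
    have hn2 : T - S < n + 1 := Nat.lt_floor_add_one _
    have h1 := h (S + n) (by linarith) T (by linarith) (by linarith)
    have h2 := step (S + n) (by linarith)
    have h3 := chain S hS n
    have h4 := abs_sub_le (L T) (L (S + n)) (L S)
    have h5 : 0 ≤ K / (S + n) := div_nonneg hK (by linarith)
    linarith
  have hC : Cauchy (map L atTop) := by
    rw [Metric.cauchy_iff]
    refine ⟨inferInstance, fun ε hε => ?_⟩
    set S := max T₀ (2 * K / ε + 2)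
    have hS1 : T₀ ≤ S := le_max_left _ _
    have hS2 : 2 * K / ε + 2 ≤ S := le_max_right _ _
    have hS3 : K / (S - 1) < ε / 2 := by
      rw [div_lt_iff₀ (by linarith)]
      have : 2 * K / ε < S - 1 := by linarith
      rw [div_lt_iff₀ hε] at this
      linarith
    refine ⟨L '' Ici S, image_mem_map (Ici_mem_atTop S), ?_⟩
    rintro _ ⟨x, hx, rfl⟩ _ ⟨y, hy, rfl⟩
    have h1 := bound S hS1 x hx
    have h2 := bound S hS1 y hy
    rw [Real.dist_eq]
    have h3 := abs_sub_le (L x) (L S) (L y)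
    rw [abs_sub_comm (L S)] at h3
    linarith
  exact cauchy_map_iff_exists_tendsto.1 hC

/-! ### Decreasing profiles and slow variation under shifts -/

/-- A positive nonincreasing function on the half-line, normalised at `0` and extended by zero. -/
structure DecreasingProfile (f : ℝ → ℝ) : Prop where
  measurable : Measurable f
  antitoneOn : AntitoneOn f (Ici 0)
  pos : ∀ t, 0 ≤ t → 0 < f t
  neg : ∀ t, t < 0 → f t = 0
  zero : f 0 = 1

/-- Shifting the argument of `f` by `x` changes `f t` by a relative error `O(1 / t)`, with a
constant that grows more slowly than any exponential in `x`. -/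
def SlowlyVaryingUnderShifts (f : ℝ → ℝ) : Prop :=
  ∀ η : ℝ, 0 < η → ∃ K T : ℝ, 0 < K ∧ 0 < T ∧ ∀ t, T ≤ t → ∀ x, 0 ≤ x →
    |f (t - x) - f t| ≤ K * Real.exp (η * x) * (f t / t)

namespace DecreasingProfile

variable {f : ℝ → ℝ}

theorem nonneg (hf : DecreasingProfile f) (t : ℝ) : 0 ≤ f t := by
  rcases lt_or_ge t 0 with h | h
  · exact (hf.neg t h).ge
  · exact (hf.pos t h).le

theorem le_one (hf : DecreasingProfile f) (t : ℝ) : f t ≤ 1 := by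
  rcases lt_or_ge t 0 with h | h
  · rw [hf.neg t h]; exact zero_le_one
  · rw [← hf.zero]; exact hf.antitoneOn self_mem_Ici h h

theorem norm_le_one (hf : DecreasingProfile f) (t : ℝ) : ‖f t‖ ≤ 1 := by
  rw [Real.norm_of_nonneg (hf.nonneg t)]; exact hf.le_one t

theorem le_of_le (hf : DecreasingProfile f) {s t : ℝ} (hs : 0 ≤ s) (h : s ≤ t) : f t ≤ f s :=
  hf.antitoneOn hs (hs.trans h : (0 : ℝ) ≤ t) h

/-- Iterate over n = ⌈s/δ⌉ steps starting at u. Each factor is at most exp(K/u), and monotonicity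
absorbs the overshoot u + nδ ≥ u + s. -/
theorem le_mul_exp_of_step (hf : DecreasingProfile f) {δ K T₀ : ℝ} (hδ : 0 < δ) (hK : 0 ≤ K)
    (hT₀ : 0 < T₀) (hstep : ∀ t, T₀ ≤ t → f (t - δ) ≤ f t * (1 + K / t)) {u s : ℝ}
    (hu : T₀ ≤ u) (hs : 0 ≤ s) : f u ≤ f (u + s) * Real.exp ((s / δ + 1) * K / u) := by
  have hu0 : 0 < u := hT₀.trans_le hu
  have chain : ∀ n : ℕ, f u ≤ f (u + n * δ) * Real.exp (n * K / u) := by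
    intro n
    induction n with
    | zero => simp
    | succ n ih =>
      have hn : (0 : ℝ) ≤ n := n.cast_nonneg
      have hnδ : 0 ≤ (n : ℝ) * δ := by positivity
      have h1 := hstep (u + n * δ + δ) (by linarith)
      rw [add_sub_cancel_right] at h1
      have h2 : 1 + K / (u + n * δ + δ) ≤ Real.exp (K / u) := by
        have : K / (u + n * δ + δ) ≤ K / u := by gcongr; linarith
        linarith [Real.add_one_le_exp (K / u)]
      push_cast
      rw [show u + ((n : ℝ) + 1) * δ = u + n * δ + δ by ring,
        show ((n : ℝ) + 1) * K / u = K / u + n * K / u by ring, Real.exp_add, ← mul_assoc]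
      refine ih.trans ?_
      gcongr
      refine h1.trans ?_
      gcongr
      exact hf.nonneg _
  set n := ⌈s / δ⌉₊
  have hn1 : s / δ ≤ n := Nat.le_ceil _
  have hn2 : (n : ℝ) < s / δ + 1 := Nat.ceil_lt_add_one (by positivity)
  have hn3 : s ≤ n * δ := by rwa [div_le_iff₀ hδ] at hn1
  refine (chain n).trans ?_
  gcongr
  · exact hf.nonneg _
  · exact hf.le_of_le (by linarith) (by linarith)

/-- Three ranges of x. For x > t the error is f(t) itself, and t < x ≤ e^{ηx}/η supplies the factor
1/t. For x ≤ t/2 the iterated step applies from t - x ≥ t/2. For t/2 ≤ x ≤ t a bound without decay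
suffices, as 1 ≤ (2/η) e^{ηx}/t. -/
theorem slowlyVaryingUnderShifts_of_step (hf : DecreasingProfile f) {δ K T₀ : ℝ} (hδ : 0 < δ)
    (hK : 0 ≤ K) (hT₀ : 0 < T₀) (hstep : ∀ t, T₀ ≤ t → f (t - δ) ≤ f t * (1 + K / t)) :
    SlowlyVaryingUnderShifts f := by
  intro η' hη'
  -- Half of the rate pays for the growth of f under shifts, the other half for a factor linear in
  -- x.
  obtain ⟨η, rfl⟩ : ∃ η, η' = η + η := ⟨η' / 2, by ring⟩
  have hη : 0 < η := by linarith
  set T₁ := max T₀ (K / (δ * η)) with hT₁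
  have hT₁0 : T₀ ≤ T₁ := le_max_left _ _
  have hT₁K : K / (δ * η) ≤ T₁ := le_max_right _ _
  have hexponent : ∀ u s, T₁ ≤ u → 0 ≤ s → (s / δ + 1) * K / u ≤ η * s + η * δ := by
    intro u s hu hs
    have h1 : K ≤ u * (δ * η) := by
      rw [div_le_iff₀ (by positivity)] at hT₁K
      exact hT₁K.trans (by gcongr)
    rw [div_le_iff₀ (by linarith), show (s / δ + 1) * K = K / δ * (s + δ) by field_simp]
    have h2 : K / δ ≤ u * η := by
      rw [div_le_iff₀ hδ]; linarith
    calc K / δ * (s + δ) ≤ u * η * (s + δ) := by gcongr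
      _ = _ := by ring
  have hfT : 0 < f T₁ := hf.pos _ (by linarith)
  set D := Real.exp (η * δ) with hD
  have hD1 : 1 ≤ D := Real.one_le_exp (by positivity)
  have hfT1 : 1 ≤ 1 / f T₁ := by
    rw [le_div_iff₀ hfT]; linarith [hf.le_one T₁]
  have large : ∀ u s, T₁ ≤ u → 0 ≤ s → f u ≤ D * Real.exp (η * s) * f (u + s) := by
    intro u s hu hs
    have h1 := hf.le_mul_exp_of_step hδ hK hT₀ hstep (hT₁0.trans hu) hs
    have h2 := Real.exp_le_exp.2 (hexponent u s hu hs)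
    rw [Real.exp_add] at h2
    have := mul_le_mul_of_nonneg_left h2 (hf.nonneg (u + s))
    linarith
  -- Below T₁ the step bound is unavailable; f ≤ 1 and the constant 1 / f(T₁) replace it.
  have all : ∀ u s, 0 ≤ u → 0 ≤ s → f u ≤ 1 / f T₁ * (D * Real.exp (η * s) * f (u + s)) := by
    intro u s hu hs
    rcases le_total T₁ u with h | h
    · refine (large u s h hs).trans (le_mul_of_one_le_left ?_ hfT1)
      have := hf.nonneg (u + s)
      positivity
    · have h1 := large T₁ s le_rfl hs
      have h2 : f (T₁ + s) ≤ f (u + s) := hf.le_of_le (by linarith) (by linarith)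
      have h3 : f T₁ ≤ D * Real.exp (η * s) * f (u + s) := h1.trans (by gcongr)
      calc f u ≤ 1 := hf.le_one u
        _ = 1 / f T₁ * f T₁ := by field_simp
        _ ≤ _ := by gcongr
  set K₁ := (1 / (δ * η) + 1) * (2 * K) * D with hK₁
  set K₂ := 1 / f T₁ * D * (2 / η) with hK₂
  have hK₁0 : 0 ≤ K₁ := by positivity
  have hK₂0 : 0 < K₂ := by positivity
  refine ⟨K₁ + K₂ + 1 / η, 2 * T₁, by positivity, by linarith, fun t ht x hx => ?_⟩
  have ht0 : 0 < t := by linarith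
  have hft : 0 < f t := hf.pos t ht0.le
  have hq : 0 < f t / t := by positivity
  have he1 : 1 ≤ Real.exp (η * x) := Real.one_le_exp (by positivity)
  have hxe := le_exp_mul_div hη x
  rw [show (η + η) * x = η * x + η * x by ring, Real.exp_add]
  set E := Real.exp (η * x) with hE
  rcases lt_or_ge t x with hxt | hxt
  · rw [hf.neg (t - x) (by linarith), zero_sub, abs_neg, abs_of_pos hft]
    have h1 : f t ≤ 1 / η * (E * E) * (f t / t) := by
      have h2 : t ≤ 1 / η * (E * E) := by
        calc t ≤ E / η := by linarith
          _ = 1 / η * (E * 1) := by ring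
          _ ≤ 1 / η * (E * E) := by gcongr
      calc f t = t * (f t / t) := by field_simp
        _ ≤ _ := by gcongr
    refine h1.trans ?_
    gcongr
    linarith
  · have hmono : f t ≤ f (t - x) := hf.le_of_le (by linarith) (by linarith)
    rw [abs_of_nonneg (by linarith)]
    rcases le_total x (t / 2) with hx2 | hx2
    · have hu : T₁ ≤ t - x := by linarith
      have h1 := hf.le_mul_exp_of_step hδ hK hT₀ hstep (hT₁0.trans hu) hx
      rw [sub_add_cancel] at h1
      set y := (x / δ + 1) * K / (t - x) with hy
      have hy0 : 0 ≤ y := div_nonneg (by positivity) (by linarith)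
      have h2 : Real.exp y ≤ E * D := by
        rw [hE, hD, ← Real.exp_add]
        exact Real.exp_le_exp.2 (hexponent _ _ hu hx)
      have h3 : Real.exp y - 1 ≤ y * Real.exp y := by
        have h4 := Real.add_one_le_exp (-y)
        have h5 : Real.exp (-y) * Real.exp y = 1 := by rw [← Real.exp_add]; simp
        nlinarith [Real.exp_pos y]
      have h6 : y ≤ (1 / (δ * η) + 1) * (2 * K) * E / t := by
        have h7 : x / δ + 1 ≤ (1 / (δ * η) + 1) * E := by
          have : x / δ ≤ 1 / (δ * η) * E := by
            rw [div_le_iff₀ hδ]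
            refine hxe.trans (le_of_eq ?_)
            field_simp
          linarith
        calc y ≤ ((1 / (δ * η) + 1) * E) * K / (t / 2) := by
              rw [hy]; gcongr; linarith
          _ = _ := by field_simp
      calc f (t - x) - f t ≤ f t * (Real.exp y - 1) := by linarith
        _ ≤ f t * ((1 / (δ * η) + 1) * (2 * K) * E / t * (E * D)) := by
            gcongr
            exact h3.trans (by gcongr)
        _ = K₁ * (E * E) * (f t / t) := by rw [hK₁]; ring
        _ ≤ _ := by
            gcongr
            have : 0 < 1 / η := by positivity
            linarith
    · have h1 := all (t - x) x (by linarith) hx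
      rw [sub_add_cancel] at h1
      have h2 : 1 ≤ 2 / η * E / t := by
        rw [le_div_iff₀ ht0]
        have : 2 / η * E = 2 * (E / η) := by ring
        linarith
      calc f (t - x) - f t ≤ 1 / f T₁ * (D * E * f t) * 1 := by linarith
        _ ≤ 1 / f T₁ * (D * E * f t) * (2 / η * E / t) := by gcongr
        _ = K₂ * (E * E) * (f t / t) := by rw [hK₂]; ring
        _ ≤ _ := by
            gcongr
            have : 0 < 1 / η := by positivity
            linarith

/-- A profile that varies slowly under shifts decays more slowly than any exponential. -/
theorem exp_neg_le (hf : DecreasingProfile f) (hs : SlowlyVaryingUnderShifts f) {η : ℝ}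
    (hη : 0 < η) : ∃ K T : ℝ, 0 < K ∧ 0 < T ∧ ∀ t, T ≤ t → Real.exp (-(η * t)) ≤ K * f t := by
  obtain ⟨K, T, hK, hT, h⟩ := hs η hη
  refine ⟨1 + K / T, T, by positivity, hT, fun t ht => ?_⟩
  have ht0 : 0 < t := hT.trans_le ht
  -- The shift x = t compares f(t) with f(0) = 1.
  have h1 := (abs_le.1 (h t ht t ht0.le)).2
  rw [sub_self, hf.zero] at h1
  have hft := hf.pos t ht0.le
  have h2 : Real.exp (-(η * t)) * Real.exp (η * t) = 1 := by rw [← Real.exp_add]; simp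
  have h3 : Real.exp (-(η * t)) ≤ 1 := Real.exp_le_one_iff.2 (by
    have : 0 ≤ η * t := by positivity
    linarith)
  have h4 : 1 ≤ f t + K * Real.exp (η * t) * (f t / t) := by linarith
  calc Real.exp (-(η * t)) = Real.exp (-(η * t)) * 1 := by ring
    _ ≤ Real.exp (-(η * t)) * (f t + K * Real.exp (η * t) * (f t / t)) := by gcongr
    _ = Real.exp (-(η * t)) * f t
          + (Real.exp (-(η * t)) * Real.exp (η * t)) * (K * (f t / t)) := by ring
    _ = Real.exp (-(η * t)) * f t + K / t * f t := by rw [h2]; ring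
    _ ≤ 1 * f t + K / T * f t := by gcongr
    _ = _ := by ring

end DecreasingProfile

theorem abs_log_one_add_sub_le {x : ℝ} (hx : |x| ≤ 1 / 2) : |Real.log (1 + x) - x| ≤ 2 * x ^ 2 := by
  have h := Real.abs_log_sub_add_sum_range_le (x := -x) (by rw [abs_neg]; linarith) 1
  simp only [Finset.range_one, Finset.sum_singleton, zero_add, pow_one, Nat.cast_zero, div_one,
    sub_neg_eq_add, abs_neg] at h
  rw [show Real.log (1 + x) - x = -x + Real.log (1 + x) by ring]
  refine h.trans ?_
  rw [div_le_iff₀ (by linarith), show (1 + 1 : ℕ) = 2 from rfl, sq_abs]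
  nlinarith [sq_nonneg x]

/-! ### Renewal defect and its primitive -/

/-- The mass `∫ a(s) ∫_{t-s}^t f` attached to the delay density `a` and the function `f`. -/
noncomputable def delayedMass (a f : ℝ → ℝ) (t : ℝ) : ℝ :=
  ∫ s in Ioi (0 : ℝ), a s * ∫ x in (0 : ℝ)..s, f (t - x)

/-- The defect of `f` in the renewal equation with delay density `a`. -/
noncomputable def renewalDefect (a f : ℝ → ℝ) (t : ℝ) : ℝ :=
  f t - ∫ s in Ioi (0 : ℝ), a s * f (t - s)

theorem abs_setIntegral_mul_sub_le {q m k : ℝ → ℝ} {η C : ℝ}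
    (hq : IntegrableOn (fun s => |q s| * Real.exp (η * s)) (Ioi 0))
    (hqk : IntegrableOn (fun s => q s * k s) (Ioi 0))
    (hqm : IntegrableOn (fun s => q s * m s) (Ioi 0))
    (h : ∀ s, 0 < s → |k s - m s| ≤ C * Real.exp (η * s)) :
    |(∫ s in Ioi (0 : ℝ), q s * k s) - ∫ s in Ioi (0 : ℝ), q s * m s| ≤
      (∫ s in Ioi (0 : ℝ), |q s| * Real.exp (η * s)) * C := by
  rw [← integral_sub hqk hqm, ← integral_mul_const, ← Real.norm_eq_abs]
  refine norm_integral_le_of_norm_le (hq.mul_const C) ?_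
  filter_upwards [ae_restrict_mem measurableSet_Ioi] with s hs
  rw [← mul_sub, Real.norm_eq_abs, abs_mul, mul_assoc, mul_comm (Real.exp _)]
  exact mul_le_mul_of_nonneg_left (h s hs) (abs_nonneg _)

theorem integrableOn_mul_id_of_exp {q : ℝ → ℝ} {η : ℝ} (hη : 0 < η)
    (hq : IntegrableOn q (Ioi 0))
    (hqe : IntegrableOn (fun s => |q s| * Real.exp (η * s)) (Ioi 0)) :
    IntegrableOn (fun s => q s * s) (Ioi 0) := by
  refine Integrable.mono' (hqe.mul_const (1 / η)) ?_ ?_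
  · exact hq.aestronglyMeasurable.mul continuous_id.aestronglyMeasurable
  · filter_upwards [ae_restrict_mem measurableSet_Ioi] with s hs
    have hs' : (0 : ℝ) < s := hs
    rw [norm_mul, Real.norm_eq_abs, Real.norm_of_nonneg hs'.le, mul_assoc]
    gcongr
    simpa [div_eq_mul_inv] using le_exp_mul_div hη s

namespace DecreasingProfile

variable {f : ℝ → ℝ}

theorem intervalIntegrable (hf : DecreasingProfile f) (α β : ℝ) :
    IntervalIntegrable f volume α β := by
  rw [intervalIntegrable_iff]
  exact Measure.integrableOn_of_bounded (M := 1) measure_Ioc_lt_top.ne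
    hf.measurable.aestronglyMeasurable (Eventually.of_forall hf.norm_le_one)

theorem intervalIntegrable_comp_sub_left (hf : DecreasingProfile f) (t α β : ℝ) :
    IntervalIntegrable (fun x => f (t - x)) volume α β := by
  rw [intervalIntegrable_iff]
  exact Measure.integrableOn_of_bounded (M := 1) measure_Ioc_lt_top.ne
    (hf.measurable.comp (measurable_const.sub measurable_id)).aestronglyMeasurable
    (Eventually.of_forall fun x => hf.norm_le_one _)

theorem intervalIntegrable_comp_sub_right (hf : DecreasingProfile f) (t α β : ℝ) :
    IntervalIntegrable (fun x => f (x - t)) volume α β := by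
  rw [intervalIntegrable_iff]
  exact Measure.integrableOn_of_bounded (M := 1) measure_Ioc_lt_top.ne
    (hf.measurable.comp (measurable_id.sub measurable_const)).aestronglyMeasurable
    (Eventually.of_forall fun x => hf.norm_le_one _)

theorem integrable_mul_comp_sub (hf : DecreasingProfile f) {μ : Measure ℝ} {q : ℝ → ℝ}
    (hq : Integrable q μ) (t : ℝ) : Integrable (fun s => q s * f (t - s)) μ :=
  hq.mul_bdd (c := 1)
    (hf.measurable.comp (measurable_const.sub measurable_id)).aestronglyMeasurable
    (Eventually.of_forall fun _ => hf.norm_le_one _)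

theorem integrableOn_mul_primitive (hf : DecreasingProfile f) {q : ℝ → ℝ} {η : ℝ} (hη : 0 < η)
    (hq : IntegrableOn q (Ioi 0))
    (hqe : IntegrableOn (fun s => |q s| * Real.exp (η * s)) (Ioi 0)) (t : ℝ) :
    IntegrableOn (fun s => q s * ∫ x in (0 : ℝ)..s, f (t - x)) (Ioi 0) := by
  refine Integrable.mono (integrableOn_mul_id_of_exp hη hq hqe) ?_ ?_
  · exact hq.aestronglyMeasurable.mul (intervalIntegral.continuous_primitive
      (fun α β => hf.intervalIntegrable_comp_sub_left t α β) 0).aestronglyMeasurable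
  · filter_upwards [ae_restrict_mem measurableSet_Ioi] with s hs
    rw [norm_mul, norm_mul]
    gcongr
    have := intervalIntegral.norm_integral_le_of_norm_le_const (a := 0) (b := s) (C := 1)
      (f := fun x => f (t - x)) fun x _ => hf.norm_le_one _
    simpa using this

/-- Averaging the shifts of `f` against `q` multiplies `f` by the total mass of `q`, up to a
relative error `O(1 / t)`. -/
theorem abs_integral_mul_comp_sub_sub_le (hf : DecreasingProfile f)
    (hs : SlowlyVaryingUnderShifts f) {q : ℝ → ℝ} {η : ℝ} (hη : 0 < η)
    (hq : IntegrableOn q (Ioi 0))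
    (hqe : IntegrableOn (fun s => |q s| * Real.exp (η * s)) (Ioi 0)) :
    ∃ K T : ℝ, 0 ≤ K ∧ 0 < T ∧ ∀ t, T ≤ t →
      |(∫ s in Ioi (0 : ℝ), q s * f (t - s)) - (∫ s in Ioi (0 : ℝ), q s) * f t| ≤
        K * (f t / t) := by
  obtain ⟨K, T, hK, hT, h⟩ := hs η hη
  refine ⟨(∫ s in Ioi (0 : ℝ), |q s| * Real.exp (η * s)) * K, T,
    mul_nonneg (integral_nonneg fun s => by positivity) hK.le, hT, fun t ht => ?_⟩
  rw [← integral_mul_const, mul_assoc]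
  refine abs_setIntegral_mul_sub_le (m := fun _ => f t) (k := fun s => f (t - s)) hqe
    (hf.integrable_mul_comp_sub hq t) (hq.mul_const _) fun s hs => ?_
  refine (h t ht s hs.le).trans (le_of_eq ?_)
  ring

theorem abs_delayedMass_sub_le (hf : DecreasingProfile f)
    (hs : SlowlyVaryingUnderShifts f) {a : ℝ → ℝ} {η : ℝ} (hη : 0 < η)
    (ha : IntegrableOn a (Ioi 0))
    (hae : IntegrableOn (fun s => |a s| * Real.exp (η * s)) (Ioi 0)) :
    ∃ K T : ℝ, 0 ≤ K ∧ 0 < T ∧ ∀ t, T ≤ t →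
      |delayedMass a f t - (∫ s in Ioi (0 : ℝ), s * a s) * f t| ≤ K * (f t / t) := by
  -- Integrating the shift error over [0, s] costs a factor s, absorbed by the other half of the
  -- rate.
  have hη2 : 0 < η / 2 := by positivity
  obtain ⟨K, T, hK, hT, h⟩ := hs (η / 2) hη2
  refine ⟨(∫ s in Ioi (0 : ℝ), |a s| * Real.exp (η * s)) * (K / (η / 2)), T,
    mul_nonneg (integral_nonneg fun s => by positivity) (by positivity), hT, fun t ht => ?_⟩
  have hft := hf.nonneg t
  have ht0 : 0 < t := hT.trans_le ht
  have hid : IntegrableOn (fun s => a s * (s * f t)) (Ioi 0) := by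
    simpa only [mul_assoc, IntegrableOn] using (integrableOn_mul_id_of_exp hη ha hae).mul_const (f t)
  have heq : (∫ s in Ioi (0 : ℝ), s * a s) * f t = ∫ s in Ioi (0 : ℝ), a s * (s * f t) := by
    rw [← integral_mul_const]
    congr 1; ext s; ring
  rw [heq, mul_assoc, delayedMass]
  refine abs_setIntegral_mul_sub_le (m := fun s => s * f t) hae
    (hf.integrableOn_mul_primitive hη ha hae t) hid fun s hs => ?_
  have h1 : s * f t = ∫ x in (0 : ℝ)..s, f t := by simp
  rw [h1, ← intervalIntegral.integral_sub (hf.intervalIntegrable_comp_sub_left t 0 s)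
    intervalIntegrable_const, ← Real.norm_eq_abs]
  have h2 : ∀ x ∈ uIoc 0 s, ‖f (t - x) - f t‖ ≤ K * Real.exp (η / 2 * s) * (f t / t) := by
    intro x hx
    rw [uIoc_of_le hs.le] at hx
    refine (h t ht x hx.1.le).trans ?_
    gcongr
    exact hx.2
  refine (intervalIntegral.norm_integral_le_of_norm_le_const h2).trans ?_
  rw [sub_zero, abs_of_pos hs]
  calc K * Real.exp (η / 2 * s) * (f t / t) * s
      ≤ K * Real.exp (η / 2 * s) * (f t / t) * (Real.exp (η / 2 * s) / (η / 2)) := by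
        gcongr
        exact le_exp_mul_div hη2 s
    _ = K / (η / 2) * (f t / t) * (Real.exp (η / 2 * s) * Real.exp (η / 2 * s)) := by ring
    _ = _ := by rw [← Real.exp_add]; ring_nf

theorem integrable_uncurry_mul_sub (hf : DecreasingProfile f) {a : ℝ → ℝ}
    (ha : IntegrableOn a (Ioi 0)) (S T : ℝ) :
    Integrable (Function.uncurry fun s u => a s * (f u - f (u - s)))
      ((volume.restrict (Ioi (0 : ℝ))).prod (volume.restrict (Ioc S T))) := by
  have h1 := Integrable.comp_fst (ν := volume.restrict (Ioc S T)) ha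
  refine h1.mul_bdd (c := 2) (g := fun p => f p.2 - f (p.2 - p.1)) ?_ ?_
  · exact ((hf.measurable.comp measurable_snd).sub
      (hf.measurable.comp (measurable_snd.sub measurable_fst))).aestronglyMeasurable
  · refine Eventually.of_forall fun p => (norm_sub_le _ _).trans ?_
    linarith [hf.norm_le_one p.2, hf.norm_le_one (p.2 - p.1)]

/-- Unit mass turns the defect into an average of increments of f, the form to which Fubini applies.
-/
theorem renewalDefect_eq (hf : DecreasingProfile f) {a : ℝ → ℝ}
    (ha : IntegrableOn a (Ioi 0)) (ha_one : ∫ s in Ioi (0 : ℝ), a s = 1) (u : ℝ) :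
    renewalDefect a f u = ∫ s in Ioi (0 : ℝ), a s * (f u - f (u - s)) := by
  simp only [mul_sub]
  rw [integral_sub (ha.mul_const _) (hf.integrable_mul_comp_sub ha u), integral_mul_const, ha_one,
    one_mul, renewalDefect]

theorem integrableOn_renewalDefect (hf : DecreasingProfile f) {a : ℝ → ℝ}
    (ha : IntegrableOn a (Ioi 0)) (ha_one : ∫ s in Ioi (0 : ℝ), a s = 1) (S T : ℝ) :
    IntegrableOn (renewalDefect a f) (Ioc S T) := by
  have h := (hf.integrable_uncurry_mul_sub ha S T).integral_prod_right
  refine h.congr (Eventually.of_forall fun u => ?_)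
  exact (hf.renewalDefect_eq ha ha_one u).symm

/-- The delayed mass is a primitive of the renewal defect. -/
theorem delayedMass_sub (hf : DecreasingProfile f) {a : ℝ → ℝ} {η : ℝ} (hη : 0 < η)
    (ha : IntegrableOn a (Ioi 0)) (ha_one : ∫ s in Ioi (0 : ℝ), a s = 1)
    (hae : IntegrableOn (fun s => |a s| * Real.exp (η * s)) (Ioi 0)) {S T : ℝ} (hST : S ≤ T) :
    delayedMass a f T - delayedMass a f S = ∫ u in S..T, renewalDefect a f u := by
  rw [delayedMass, delayedMass, ← integral_sub (hf.integrableOn_mul_primitive hη ha hae T)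
    (hf.integrableOn_mul_primitive hη ha hae S), intervalIntegral.integral_of_le hST]
  have h1 : ∀ s, a s * (∫ x in (0 : ℝ)..s, f (T - x)) - a s * (∫ x in (0 : ℝ)..s, f (S - x)) =
      ∫ u in Ioc S T, a s * (f u - f (u - s)) := by
    intro s
    rw [integral_const_mul, ← mul_sub, ← intervalIntegral.integral_of_le hST,
      intervalIntegral.integral_sub (hf.intervalIntegrable S T)
        (hf.intervalIntegrable_comp_sub_right s S T),
      intervalIntegral.integral_comp_sub_left, intervalIntegral.integral_comp_sub_left,
      intervalIntegral.integral_comp_sub_right, sub_zero, sub_zero]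
    -- Window identity: ∫_{T-s}^T f - ∫_{S-s}^S f = ∫_S^T f - ∫_{S-s}^{T-s} f.
    have h2 := intervalIntegral.integral_add_adjacent_intervals
      (hf.intervalIntegrable (S - s) (T - s)) (hf.intervalIntegrable (T - s) T)
    have h3 := intervalIntegral.integral_add_adjacent_intervals
      (hf.intervalIntegrable (S - s) S) (hf.intervalIntegrable S T)
    congr 1
    linarith
  simp only [h1, hf.renewalDefect_eq ha ha_one]
  exact integral_integral_swap (hf.integrable_uncurry_mul_sub ha S T)

end DecreasingProfile

/-! ### From the defect to the power law -/

namespace DecreasingProfile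

variable {f : ℝ → ℝ}

/-- Lets f(u)/u be frozen at S over a unit step: the shift by u - S ≤ 1 costs O(f(S)/S), and 1/S -
1/u ≤ 1/S². -/
theorem abs_div_sub_div_le (hf : DecreasingProfile f) (hs : SlowlyVaryingUnderShifts f) :
    ∃ K T : ℝ, 0 ≤ K ∧ 0 < T ∧ ∀ S, T ≤ S → ∀ u, S ≤ u → u ≤ S + 1 →
      |f u / u - f S / S| ≤ K * (f S / S ^ 2) := by
  obtain ⟨K, T, hK, hT, h⟩ := hs 1 one_pos
  refine ⟨K * Real.exp 1 + 1, T, by positivity, hT, fun S hS u hu hu1 => ?_⟩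
  have hS0 : 0 < S := hT.trans_le hS
  have hu0 : 0 < u := hS0.trans_le hu
  have hfu : f u ≤ f S := hf.le_of_le hS0.le hu
  have hfu0 := hf.nonneg u
  have hfS0 := hf.nonneg S
  have h1 := (abs_le.1 (h u (hS.trans hu) (u - S) (by linarith))).2
  rw [sub_sub_cancel, one_mul] at h1
  have h2 : f S - f u ≤ K * Real.exp 1 * (f S / S) :=
    h1.trans (by gcongr; linarith)
  have h3 : f u / u ≤ f S / S := by gcongr
  rw [abs_sub_comm, abs_of_nonneg (by linarith)]
  have h4 : 1 / S - 1 / u ≤ 1 / S ^ 2 := by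
    rw [div_sub_div _ _ hS0.ne' hu0.ne', div_le_div_iff₀ (by positivity) (by positivity)]
    nlinarith
  have h5 : 0 ≤ 1 / S - 1 / u := sub_nonneg.2 (by gcongr)
  calc f S / S - f u / u = (f S - f u) / S + f u * (1 / S - 1 / u) := by ring
    _ ≤ K * Real.exp 1 * (f S / S) / S + f S * (1 / S ^ 2) := by gcongr
    _ = _ := by ring

/-- A slowly varying profile whose renewal defect is asymptotic to `B f(t) / t`, with a relative
error `O(t⁻²)`, is asymptotic to a multiple of the power with exponent `B` over the mean delay. -/
theorem exists_tendsto_mul_rpow (hf : DecreasingProfile f) (hs : SlowlyVaryingUnderShifts f)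
    {a : ℝ → ℝ} {η B K₀ T₀ : ℝ} (hη : 0 < η) (ha : IntegrableOn a (Ioi 0))
    (ha_one : ∫ s in Ioi (0 : ℝ), a s = 1)
    (hae : IntegrableOn (fun s => |a s| * Real.exp (η * s)) (Ioi 0))
    (hμ : 0 < ∫ s in Ioi (0 : ℝ), s * a s) (hK₀ : 0 ≤ K₀)
    (hdef : ∀ u, T₀ ≤ u → |renewalDefect a f u - B * (f u / u)| ≤ K₀ * (f u / u ^ 2)) :
    ∃ C : ℝ, 0 < C ∧
      Tendsto (fun t => f t * t ^ (-(B / ∫ s in Ioi (0 : ℝ), s * a s))) atTop (𝓝 C) := by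
  set μ := ∫ s in Ioi (0 : ℝ), s * a s with hμdef
  set γ := B / μ with hγ
  have hB : B = γ * μ := by rw [hγ]; field_simp
  set M := delayedMass a f with hM
  obtain ⟨Km, Tm, hKm, hTm, hm⟩ := hf.abs_delayedMass_sub_le hs hη ha hae
  obtain ⟨Kd, Td, hKd, hTd, hd⟩ := hf.abs_div_sub_div_le hs
  set T₁ := max (max Tm Td) (max T₀ (max 2 (2 * Km / μ))) with hT₁
  have hT₁m : Tm ≤ T₁ := (le_max_left _ _).trans (le_max_left _ _)
  have hT₁d : Td ≤ T₁ := (le_max_right _ _).trans (le_max_left _ _)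
  have hT₁0 : T₀ ≤ T₁ := (le_max_left _ _).trans (le_max_right _ _)
  have hT₁2 : 2 ≤ T₁ := (le_max_left _ _).trans ((le_max_right _ _).trans (le_max_right _ _))
  have hT₁μ : 2 * Km / μ ≤ T₁ :=
    (le_max_right _ _).trans ((le_max_right _ _).trans (le_max_right _ _))
  -- From S ≥ 2 Km/μ, the error in M = μf + O(f/S) is at most half the main term.
  have hfM : ∀ S, T₁ ≤ S → f S ≤ 2 / μ * M S := by
    intro S hS
    have hS0 : 0 < S := by linarith
    have h1 := (abs_le.1 (hm S (hT₁m.trans hS))).1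
    have h2 : Km * (f S / S) ≤ μ / 2 * f S := by
      have h3 : Km / S ≤ μ / 2 := by
        rw [div_le_iff₀ hS0]
        rw [div_le_iff₀ hμ] at hT₁μ
        nlinarith
      calc Km * (f S / S) = Km / S * f S := by ring
        _ ≤ _ := by
          gcongr
          exact hf.nonneg S
    rw [div_mul_eq_mul_div, le_div_iff₀ hμ]
    linarith
  have hMpos : ∀ S, T₁ ≤ S → 0 < M S := by
    intro S hS
    have h1 := hfM S hS
    have h2 := hf.pos S (by linarith)
    by_contra h3
    have : 2 / μ * M S ≤ 0 := mul_nonpos_of_nonneg_of_nonpos (by positivity) (not_lt.1 h3)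
    linarith
  -- Three errors: the defect asymptotics, freezing f(u)/u at S, and replacing μ f(S) by M(S).
  set K₃ := K₀ + |B| * Kd + |γ| * Km with hK₃
  have hincr : ∀ S, T₁ ≤ S → ∀ T, S ≤ T → T ≤ S + 1 →
      |M T - M S - γ * ((T - S) / S) * M S| ≤ K₃ * (f S / S ^ 2) := by
    intro S hS T hST hT
    have hS0 : 0 < S := by linarith
    have hfS := hf.nonneg S
    have h1 : ∀ u ∈ uIoc S T, ‖renewalDefect a f u - B * (f S / S)‖ ≤
        (K₀ + |B| * Kd) * (f S / S ^ 2) := by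
      intro u hu
      rw [uIoc_of_le hST] at hu
      have hu0 : 0 < u := hS0.trans hu.1
      have h2 := hdef u (hT₁0.trans (hS.trans hu.1.le))
      have h3 := hd S (hT₁d.trans hS) u hu.1.le (hu.2.trans hT)
      have h4 : f u / u ^ 2 ≤ f S / S ^ 2 := by
        gcongr
        · exact hf.le_of_le hS0.le hu.1.le
        · exact hu.1.le
      have h5 := abs_sub_le (renewalDefect a f u) (B * (f u / u)) (B * (f S / S))
      rw [← mul_sub, abs_mul] at h5
      have h6 := mul_le_mul_of_nonneg_left h3 (abs_nonneg B)
      have h7 := mul_le_mul_of_nonneg_left h4 hK₀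
      rw [Real.norm_eq_abs]
      linarith
    have hint : IntervalIntegrable (renewalDefect a f) volume S T := by
      rw [intervalIntegrable_iff_integrableOn_Ioc_of_le hST]
      exact hf.integrableOn_renewalDefect ha ha_one S T
    have h2 := intervalIntegral.norm_integral_le_of_norm_le_const h1
    rw [intervalIntegral.integral_sub hint intervalIntegrable_const,
      ← hf.delayedMass_sub hη ha ha_one hae hST, intervalIntegral.integral_const, smul_eq_mul,
      Real.norm_eq_abs, abs_of_nonneg (sub_nonneg.2 hST)] at h2
    have hc0 : 0 ≤ (K₀ + |B| * Kd) * (f S / S ^ 2) := by positivity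
    have h3 : (K₀ + |B| * Kd) * (f S / S ^ 2) * (T - S) ≤ (K₀ + |B| * Kd) * (f S / S ^ 2) :=
      mul_le_of_le_one_right hc0 (by linarith)
    have h4 : |(T - S) * (B * (f S / S)) - γ * ((T - S) / S) * M S| ≤
        |γ| * Km * (f S / S ^ 2) := by
      have h5 : (T - S) * (B * (f S / S)) - γ * ((T - S) / S) * M S =
          -(γ * ((T - S) / S) * (M S - μ * f S)) := by
        rw [hB]; ring
      rw [h5, abs_neg, abs_mul, abs_mul]
      have h6 : |(T - S) / S| ≤ 1 / S := by
        rw [abs_of_nonneg (div_nonneg (sub_nonneg.2 hST) hS0.le)]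
        gcongr
        linarith
      calc |γ| * |(T - S) / S| * |M S - μ * f S| ≤ |γ| * (1 / S) * (Km * (f S / S)) := by
            gcongr
            exact hm S (hT₁m.trans hS)
        _ = _ := by ring
    have h7 := abs_sub_le (M T - M S) ((T - S) * (B * (f S / S))) (γ * ((T - S) / S) * M S)
    rw [hK₃, add_mul]
    linarith
  have hK₃0 : 0 ≤ K₃ := by positivity
  set K₄ := K₃ * (2 / μ) with hK₄
  have hK₄0 : 0 ≤ K₄ := by positivity
  set K₅ := |γ| + K₄ with hK₅
  have hK₅0 : 0 ≤ K₅ := by positivity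
  set L : ℝ → ℝ := fun t => Real.log (M t) - γ * Real.log t with hL
  obtain ⟨l, hl⟩ : ∃ l, Tendsto L atTop (𝓝 l) := by
    -- 2 K₅² comes from log(1+x) - x, K₄ from x - γy, and 2|γ| from log(1+y) - y; S ≥ 2 K₅ ensures
    -- |x| ≤ 1/2.
    refine exists_tendsto_of_increment_le (K := 2 * K₅ ^ 2 + K₄ + |γ| * 2)
      (T₀ := max T₁ (2 * K₅)) (by positivity)
      (lt_of_lt_of_le (by linarith) (le_max_left _ _)) fun S hS T hST hT => ?_
    have hS1 : T₁ ≤ S := (le_max_left _ _).trans hS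
    have hS5 : 2 * K₅ ≤ S := (le_max_right _ _).trans hS
    have hS0 : 0 < S := by linarith
    have hMS := hMpos S hS1
    have hMT := hMpos T (hS1.trans hST)
    set y := (T - S) / S with hy
    set x := M T / M S - 1 with hx
    have hy0 : 0 ≤ y := div_nonneg (sub_nonneg.2 hST) hS0.le
    have hy1 : y ≤ 1 / S := by rw [hy]; gcongr; linarith
    have hS2 : 1 / S ≤ 1 / 2 := by gcongr; linarith
    have hxy : |x - γ * y| ≤ K₄ / S ^ 2 := by
      have h1 := hincr S hS1 T hST hT
      have h2 : x - γ * y = (M T - M S - γ * y * M S) / M S := by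
        rw [hx]; field_simp
      rw [h2, abs_div, abs_of_pos hMS, div_le_iff₀ hMS]
      refine h1.trans ?_
      have h3 := hfM S hS1
      calc K₃ * (f S / S ^ 2) ≤ K₃ * (2 / μ * M S / S ^ 2) := by gcongr
        _ = _ := by rw [hK₄]; ring
    have hxS : |x| ≤ K₅ / S := by
      have h1 : |x| ≤ |x - γ * y| + |γ * y| := by
        have := abs_add_le (x - γ * y) (γ * y)
        rwa [sub_add_cancel] at this
      rw [abs_mul, abs_of_nonneg hy0] at h1
      have h2 : |γ| * y ≤ |γ| / S := by
        rw [div_eq_mul_one_div]; gcongr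
      have h3 : K₄ / S ^ 2 ≤ K₄ / S := by
        gcongr
        nlinarith
      rw [hK₅, add_div]
      linarith
    have hx2 : |x| ≤ 1 / 2 := by
      refine hxS.trans ?_
      rw [div_le_iff₀ hS0]; linarith
    have hlogM : Real.log (M T) - Real.log (M S) = Real.log (1 + x) := by
      rw [← Real.log_div hMT.ne' hMS.ne', hx]; ring_nf
    have hlogT : Real.log T - Real.log S = Real.log (1 + y) := by
      rw [← Real.log_div (by linarith) hS0.ne', hy]
      congr 1; field_simp; ring
    have e1 := abs_log_one_add_sub_le hx2
    have e2 := abs_log_one_add_sub_le (x := y) (by rw [abs_of_nonneg hy0]; linarith)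
    have e3 : 2 * x ^ 2 ≤ 2 * K₅ ^ 2 / S ^ 2 := by
      rw [← sq_abs, mul_div_assoc, ← div_pow]
      gcongr
    have e4 : 2 * y ^ 2 ≤ 2 / S ^ 2 := by
      have : y ^ 2 ≤ (1 / S) ^ 2 := by gcongr
      calc 2 * y ^ 2 ≤ 2 * (1 / S) ^ 2 := by gcongr
        _ = _ := by ring
    have e5 : L T - L S = (Real.log (1 + x) - x) + (x - γ * y) - γ * (Real.log (1 + y) - y) := by
      rw [← hlogM, ← hlogT, hL]; ring
    have e6 := abs_sub ((Real.log (1 + x) - x) + (x - γ * y)) (γ * (Real.log (1 + y) - y))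
    have e7 := abs_add_le (Real.log (1 + x) - x) (x - γ * y)
    rw [abs_mul] at e6
    have e8 : |γ| * |Real.log (1 + y) - y| ≤ |γ| * (2 / S ^ 2) := by
      gcongr
      exact e2.trans e4
    rw [e5, add_div, add_div, mul_div_assoc |γ|]
    linarith
  have hratio : Tendsto (fun t => M t / f t) atTop (𝓝 μ) := by
    rw [tendsto_iff_dist_tendsto_zero]
    refine squeeze_zero' (Eventually.of_forall fun _ => dist_nonneg) ?_
      (tendsto_const_nhds.div_atTop tendsto_id : Tendsto (fun t : ℝ => Km / t) atTop (𝓝 0))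
    filter_upwards [eventually_ge_atTop T₁] with t ht
    have hft := hf.pos t (by linarith)
    rw [Real.dist_eq, show M t / f t - μ = (M t - μ * f t) / f t by field_simp, abs_div,
      abs_of_pos hft, div_le_iff₀ hft]
    refine (hm t (hT₁m.trans ht)).trans (le_of_eq ?_)
    ring
  refine ⟨Real.exp l / μ, by positivity, ?_⟩
  refine (((Real.continuous_exp.tendsto l).comp hl).div hratio hμ.ne').congr' ?_
  filter_upwards [eventually_ge_atTop T₁] with t ht
  have hft := hf.pos t (by linarith)
  have ht0 : 0 < t := by linarith
  have hMt := hMpos t ht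
  simp only [Pi.div_apply, Function.comp_apply, hL]
  rw [Real.exp_sub, Real.exp_log hMt, Real.rpow_def_of_pos ht0, mul_neg, Real.exp_neg,
    mul_comm γ]
  field_simp

end DecreasingProfile

/-! ### Estimates on the kernel -/

/-- A directly Riemann integrable function bounds its argument by a decaying exponential. -/
theorem DirectlyRiemannIntegrable.exists_le_exp_neg {h k : ℝ → ℝ} {z : ℝ} (hz : 1 < z)
    (hh : DirectlyRiemannIntegrable h) (hk : ∀ t, 0 ≤ t → h t = z ^ t * k t) :
    ∃ K : ℝ, 0 < K ∧ ∀ t : ℝ, 0 ≤ t → k t ≤ K * Real.exp (-(Real.log z * t)) := by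
  obtain ⟨K, hK, hb⟩ := hh.exists_le
  refine ⟨K, hK, fun t ht => ?_⟩
  have h1 := hb t ht
  rw [hk t ht, Real.rpow_def_of_pos (by linarith)] at h1
  rwa [Real.exp_neg, ← div_eq_mul_inv, le_div_iff₀ (Real.exp_pos _), mul_comm]

/-- On (t, ∞) one has 1 ≤ e^{η(s-t)}, so the tail is O(e^{-ηt}); only 1/t is kept. -/
theorem setIntegral_Ioi_abs_le {q : ℝ → ℝ} {η t : ℝ} (hη : 0 < η) (ht : 0 < t)
    (hq : IntegrableOn q (Ioi 0))
    (hqe : IntegrableOn (fun s => |q s| * Real.exp (η * s)) (Ioi 0)) :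
    ∫ s in Ioi t, |q s| ≤ (∫ s in Ioi (0 : ℝ), |q s| * Real.exp (η * s)) * (1 / η) / t := by
  have hsub : Ioi t ⊆ Ioi (0 : ℝ) := Ioi_subset_Ioi ht.le
  have h1 : ∫ s in Ioi t, |q s| ≤
      ∫ s in Ioi t, |q s| * Real.exp (η * s) * Real.exp (-(η * t)) := by
    refine integral_mono_ae (hq.mono_set hsub).abs ((hqe.mono_set hsub).mul_const _) ?_
    filter_upwards [ae_restrict_mem measurableSet_Ioi] with s hs
    rw [mul_assoc, ← Real.exp_add]
    refine le_mul_of_one_le_right (abs_nonneg _) (Real.one_le_exp ?_)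
    have : η * t ≤ η * s := by gcongr; exact (le_of_lt hs)
    linarith
  rw [integral_mul_const] at h1
  have h2 : ∫ s in Ioi t, |q s| * Real.exp (η * s) ≤
      ∫ s in Ioi (0 : ℝ), |q s| * Real.exp (η * s) :=
    setIntegral_mono_set hqe (Eventually.of_forall fun s => by positivity) hsub.eventuallyLE
  have h3 : 0 ≤ ∫ s in Ioi (0 : ℝ), |q s| * Real.exp (η * s) :=
    integral_nonneg fun s => by positivity
  refine h1.trans ?_
  rw [mul_div_assoc]
  gcongr
  exact exp_neg_le_div hη ht

/-- Up to `O(1 / t)`, the mass of the Volterra kernel over `[x, t]` is that of `a` over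
`(x, ∞)`. -/
theorem abs_integral_volterraKernel_sub_le {a b : ℝ → ℝ} {c : ℝ → ℝ → ℝ} {d η K : ℝ}
    (hd : 0 < d) (hη : 0 < η) (hK : 0 ≤ K)
    (ha : IntegrableOn a (Ioi 0)) (hb : IntegrableOn b (Ioi 0))
    (hae : IntegrableOn (fun s => |a s| * Real.exp (η * s)) (Ioi 0))
    (hc_int : ∀ t : ℝ, 0 < t → IntegrableOn (c t) (Icc 0 t))
    (hc : ∀ t : ℝ, 0 ≤ t → ∫ s in (0 : ℝ)..t, |c t s| ≤ K * Real.exp (-(η * t))) :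
    ∃ K' : ℝ, 0 ≤ K' ∧ ∀ t x : ℝ, 0 < t → 0 ≤ x → x ≤ t →
      |(∫ s in x..t, volterraKernel a b c d t s) - ∫ s in Ioi x, a s| ≤ K' / t := by
  set A := (∫ s in Ioi (0 : ℝ), |a s| * Real.exp (η * s)) * (1 / η) with hA
  have hA0 : 0 ≤ A := mul_nonneg (integral_nonneg fun s => by positivity) (by positivity)
  set Bb := ∫ s in Ioi (0 : ℝ), |b s| with hBb
  have hBb0 : 0 ≤ Bb := integral_nonneg fun s => abs_nonneg _
  -- A covers the tail of `a` beyond t, Bb the term in `b`, and K/η the term in `c`.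
  refine ⟨A + Bb + K * (1 / η), by positivity, fun t x ht hx hxt => ?_⟩
  have hsub : Ioc x t ⊆ Ioi (0 : ℝ) := fun s hs => hx.trans_lt hs.1
  have hsub' : Ioc x t ⊆ Icc (0 : ℝ) t := fun s hs => ⟨(hsub hs).le, hs.2⟩
  have hax := ha.mono_set hsub
  have hbx := hb.mono_set hsub
  have hcx := (hc_int t ht).mono_set hsub'
  rw [intervalIntegral.integral_of_le hxt]
  have e1 : ∫ s in Ioc x t, volterraKernel a b c d t s =
      (∫ s in Ioc x t, a s) + (∫ s in Ioc x t, b s) / (t + d) + ∫ s in Ioc x t, c t s := by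
    simp only [volterraKernel]
    have hb' : IntegrableOn (fun s => b s / (t + d)) (Ioc x t) := hbx.div_const _
    have hab : IntegrableOn (fun s => a s + b s / (t + d)) (Ioc x t) := hax.add hb'
    rw [integral_add hab hcx, integral_add hax hb', integral_div]
  have e2 : ∫ s in Ioi x, a s = (∫ s in Ioc x t, a s) + ∫ s in Ioi t, a s := by
    rw [← Ioc_union_Ioi_eq_Ioi hxt, setIntegral_union (Ioc_disjoint_Ioi le_rfl) measurableSet_Ioi
      hax (ha.mono_set (Ioi_subset_Ioi ht.le))]
  rw [e1, e2]
  have b1 : |∫ s in Ioi t, a s| ≤ A / t :=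
    (abs_integral_le_integral_abs).trans (setIntegral_Ioi_abs_le hη ht ha hae)
  have b2 : |(∫ s in Ioc x t, b s) / (t + d)| ≤ Bb / t := by
    rw [abs_div, abs_of_pos (by linarith : 0 < t + d)]
    have : |∫ s in Ioc x t, b s| ≤ Bb := abs_integral_le_integral_abs.trans
      (setIntegral_mono_set hb.abs (Eventually.of_forall fun s => abs_nonneg _) hsub.eventuallyLE)
    gcongr
    linarith
  have b3 : |∫ s in Ioc x t, c t s| ≤ K * (1 / η) / t := by
    have h1 : ∫ s in Ioc x t, |c t s| ≤ ∫ s in Ioc 0 t, |c t s| :=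
      setIntegral_mono_set ((hc_int t ht).mono_set Ioc_subset_Icc_self).abs
        (Eventually.of_forall fun s => abs_nonneg _) (Ioc_subset_Ioc_left hx).eventuallyLE
    have h2 := hc t ht.le
    rw [intervalIntegral.integral_of_le ht.le] at h2
    have h3 := mul_le_mul_of_nonneg_left (exp_neg_le_div hη ht) hK
    refine abs_integral_le_integral_abs.trans ?_
    rw [mul_div_assoc]
    linarith
  rw [add_div, add_div]
  rw [abs_le] at b1 b2 b3 ⊢
  constructor <;> linarith

/-- The primitive of `a` is continuous and vanishes at 0, so a short initial interval carries less
than half of the mass. -/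
theorem exists_pos_half_le_setIntegral_Ioi {a : ℝ → ℝ} (ha : IntegrableOn a (Ioi 0))
    (ha_one : ∫ s in Ioi (0 : ℝ), a s = 1) : ∃ δ : ℝ, 0 < δ ∧ 1 / 2 ≤ ∫ s in Ioi δ, a s := by
  have hi : Integrable ((Ioi (0 : ℝ)).indicator a) := ha.integrable_indicator measurableSet_Ioi
  have hcont := intervalIntegral.continuous_primitive
    (fun α β => hi.intervalIntegrable (a := α) (b := β)) 0
  have hev : ∀ᶠ δ in 𝓝[>] (0 : ℝ),
      ∫ s in (0 : ℝ)..δ, (Ioi (0 : ℝ)).indicator a s < 1 / 2 := by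
    refine (hcont.tendsto 0).mono_left nhdsWithin_le_nhds |>.eventually (gt_mem_nhds ?_)
    simp
  obtain ⟨δ, hδ, hδ0⟩ := (hev.and self_mem_nhdsWithin).exists
  have hδ0' : (0 : ℝ) < δ := hδ0
  refine ⟨δ, hδ0', ?_⟩
  rw [intervalIntegral.integral_of_le hδ0'.le, setIntegral_indicator measurableSet_Ioi,
    inter_eq_left.2 Ioc_subset_Ioi_self] at hδ
  rw [← Ioc_union_Ioi_eq_Ioi hδ0'.le, setIntegral_union (Ioc_disjoint_Ioi le_rfl)
    measurableSet_Ioi (ha.mono_set Ioc_subset_Ioi_self)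
    (ha.mono_set (Ioi_subset_Ioi hδ0'.le))] at ha_one
  linarith

theorem setIntegral_id_mul_pos {a : ℝ → ℝ} (hid : IntegrableOn (fun s => s * a s) (Ioi 0))
    (ha_nonneg : ∀ᵐ s ∂(volume.restrict (Ioi (0 : ℝ))), 0 ≤ a s)
    (ha_one : ∫ s in Ioi (0 : ℝ), a s = 1) : 0 < ∫ s in Ioi (0 : ℝ), s * a s := by
  have hnn : 0 ≤ᵐ[volume.restrict (Ioi (0 : ℝ))] fun s => s * a s := by
    filter_upwards [ha_nonneg, ae_restrict_mem measurableSet_Ioi] with s h1 h2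
    exact mul_nonneg (le_of_lt h2) h1
  refine lt_of_le_of_ne (integral_nonneg_of_ae hnn) fun h => ?_
  have h0 := (integral_eq_zero_iff_of_nonneg_ae hnn hid).1 h.symm
  have : ∫ s in Ioi (0 : ℝ), a s = 0 := by
    refine integral_eq_zero_of_ae ?_
    filter_upwards [h0, ae_restrict_mem measurableSet_Ioi] with s h1 h2
    exact (mul_eq_zero.1 h1).resolve_left (ne_of_gt h2)
  linarith

/-! ### From the Volterra equation to slow variation and the defect -/

namespace DecreasingProfile

variable {f : ℝ → ℝ}

/-- A supersolution of a Volterra equation with a nonnegative kernel `w` loses over a lag `δ` at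
most what the total mass of `w` lacks to one. -/
theorem sub_mul_integral_le (hf : DecreasingProfile f) {w : ℝ → ℝ} {t δ : ℝ} (hδ : 0 ≤ δ)
    (hδt : δ ≤ t) (hw : IntegrableOn w (Ioc 0 t))
    (hw0 : ∀ᵐ s ∂(volume.restrict (Ioc 0 t)), 0 ≤ w s)
    (hsup : ∫ s in (0 : ℝ)..t, w s * f (t - s) ≤ f t) :
    (f (t - δ) - f t) * ∫ s in δ..t, w s ≤ f t * (1 - ∫ s in (0 : ℝ)..t, w s) := by
  have ht : 0 ≤ t := hδ.trans hδt
  rw [intervalIntegral.integral_of_le ht] at hsup ⊢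
  rw [intervalIntegral.integral_of_le hδt]
  have h1 : ∫ s in Ioc 0 t, w s * (f (t - s) - f t) =
      (∫ s in Ioc 0 t, w s * f (t - s)) - f t * ∫ s in Ioc 0 t, w s := by
    simp only [mul_sub]
    rw [integral_sub (hf.integrable_mul_comp_sub hw t) (hw.mul_const _), integral_mul_const,
      mul_comm (f t)]
  have hsub : Ioc δ t ⊆ Ioc 0 t := Ioc_subset_Ioc_left hδ
  have hint : IntegrableOn (fun s => w s * (f (t - s) - f t)) (Ioc 0 t) := by
    simp only [mul_sub]
    exact (hf.integrable_mul_comp_sub hw t).sub (hw.mul_const _)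
  -- Monotonicity of f and w ≥ 0 make the integrand nonnegative, so (0, δ] can be dropped.
  have h2 : ∫ s in Ioc δ t, w s * (f (t - s) - f t) ≤
      ∫ s in Ioc 0 t, w s * (f (t - s) - f t) := by
    refine setIntegral_mono_set hint ?_ hsub.eventuallyLE
    filter_upwards [hw0, ae_restrict_mem measurableSet_Ioc] with s h3 h4
    exact mul_nonneg h3 (sub_nonneg.2 (hf.le_of_le (by linarith [h4.2]) (by linarith [h4.1])))
  have h3 : ∫ s in Ioc δ t, w s * (f (t - δ) - f t) ≤
      ∫ s in Ioc δ t, w s * (f (t - s) - f t) := by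
    refine integral_mono_ae ((hw.mono_set hsub).mul_const _) (hint.mono_set hsub) ?_
    filter_upwards [ae_restrict_of_ae_restrict_of_subset hsub hw0,
      ae_restrict_mem measurableSet_Ioc] with s h4 h5
    refine mul_le_mul_of_nonneg_left (sub_le_sub_right (hf.le_of_le ?_ ?_) _) h4
    · linarith [h5.2]
    · linarith [h5.1]
  rw [integral_mul_const] at h3
  linarith

theorem integral_mul_comp_sub_eq (hf : DecreasingProfile f) (q : ℝ → ℝ) {t : ℝ} (ht : 0 ≤ t) :
    ∫ s in (0 : ℝ)..t, q s * f (t - s) = ∫ s in Ioi (0 : ℝ), q s * f (t - s) := by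
  rw [intervalIntegral.integral_of_le ht]
  refine setIntegral_eq_of_subset_of_forall_sdiff_eq_zero measurableSet_Ioi
    Ioc_subset_Ioi_self ?_ |>.symm
  intro s hs
  have : t < s := by
    by_contra h
    exact hs.2 ⟨hs.1, not_lt.1 h⟩
  rw [hf.neg (t - s) (by linarith), mul_zero]

end DecreasingProfile

/-- The extension by zero of a positive nonincreasing function is a decreasing profile. -/
theorem decreasingProfile_indicator {g : ℝ → ℝ} (hg_zero : g 0 = 1)
    (hg_pos : ∀ T : ℝ, 0 < T → ∃ t : ℝ, T < t ∧ 0 < g t) (hg_anti : AntitoneOn g (Ici 0)) :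
    DecreasingProfile ((Ici (0 : ℝ)).indicator g) := by
  have hval : ∀ t, 0 ≤ t → (Ici (0 : ℝ)).indicator g t = g t := fun t ht => indicator_of_mem ht g
  refine ⟨?_, ?_, ?_, ?_, ?_⟩
  -- Measurability comes from monotonicity alone, after making g constant on the negative axis.
  · have h1 : (Ici (0 : ℝ)).indicator g = (Ici (0 : ℝ)).indicator fun x => g (max x 0) := by
      refine indicator_congr fun x hx => ?_
      rw [max_eq_left hx]
    have h2 : Antitone fun x => g (max x 0) := fun x y hxy =>
      hg_anti (le_max_right x 0) (le_max_right y 0) (max_le_max_right 0 hxy)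
    rw [h1]
    exact h2.measurable.indicator measurableSet_Ici
  · exact hg_anti.congr fun x hx => (hval x hx).symm
  · intro t ht
    rw [hval t ht]
    obtain ⟨u, hu, hgu⟩ := hg_pos (t + 1) (by linarith)
    have hut : t ≤ u := by linarith
    exact hgu.trans_le (hg_anti ht (ht.trans hut : (0 : ℝ) ≤ u) hut)
  · exact fun t ht => indicator_of_notMem (not_le.2 ht) g
  · rw [hval 0 le_rfl, hg_zero]

theorem integrableOn_volterraKernel {a b : ℝ → ℝ} {c : ℝ → ℝ → ℝ} {d t : ℝ}
    (ha : IntegrableOn a (Ioi 0)) (hb : IntegrableOn b (Ioi 0))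
    (hc : IntegrableOn (c t) (Icc 0 t)) :
    IntegrableOn (volterraKernel a b c d t) (Ioc 0 t) :=
  ((ha.mono_set Ioc_subset_Ioi_self).add ((hb.mono_set Ioc_subset_Ioi_self).div_const _)).add
    (hc.mono_set Ioc_subset_Icc_self)

namespace DecreasingProfile

variable {f : ℝ → ℝ}

/-- A profile that is a supersolution of the Volterra equation varies slowly under shifts. -/
theorem slowlyVaryingUnderShifts (hf : DecreasingProfile f) {a b : ℝ → ℝ} {c : ℝ → ℝ → ℝ}
    {d η K : ℝ} (hd : 0 < d) (hη : 0 < η) (hK : 0 ≤ K)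
    (ha : IntegrableOn a (Ioi 0)) (ha_one : ∫ s in Ioi (0 : ℝ), a s = 1)
    (hb : IntegrableOn b (Ioi 0))
    (hae : IntegrableOn (fun s => |a s| * Real.exp (η * s)) (Ioi 0))
    (hc_int : ∀ t : ℝ, 0 < t → IntegrableOn (c t) (Icc 0 t))
    (hc : ∀ t : ℝ, 0 ≤ t → ∫ s in (0 : ℝ)..t, |c t s| ≤ K * Real.exp (-(η * t)))
    (hw : ∀ t : ℝ, 0 < t → ∀ᵐ s ∂(volume.restrict (Icc 0 t)), 0 ≤ volterraKernel a b c d t s)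
    (hsup : ∀ t : ℝ, 0 < t → ∫ s in (0 : ℝ)..t, volterraKernel a b c d t s * f (t - s) ≤ f t) :
    SlowlyVaryingUnderShifts f := by
  obtain ⟨K', hK', hmass⟩ := abs_integral_volterraKernel_sub_le hd hη hK ha hb hae hc_int hc
  obtain ⟨δ, hδ, hδa⟩ := exists_pos_half_le_setIntegral_Ioi ha ha_one
  -- For t ≥ 4K' the mass on [δ, t] is at least 1/2 - K'/t ≥ 1/4; dividing by it gives 4K'.
  refine hf.slowlyVaryingUnderShifts_of_step (K := 4 * K') (T₀ := max δ (4 * K')) hδ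
    (by positivity) (lt_max_of_lt_left hδ) fun t ht => ?_
  have htδ : δ ≤ t := (le_max_left _ _).trans ht
  have htK : 4 * K' ≤ t := (le_max_right _ _).trans ht
  have ht0 : 0 < t := hδ.trans_le htδ
  have h1 := hf.sub_mul_integral_le hδ.le htδ (integrableOn_volterraKernel ha hb (hc_int t ht0))
    (ae_restrict_of_ae_restrict_of_subset Ioc_subset_Icc_self (hw t ht0)) (hsup t ht0)
  have h2 := (abs_le.1 (hmass t 0 ht0 le_rfl ht0.le)).1
  have h3 := (abs_le.1 (hmass t δ ht0 hδ.le htδ)).1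
  rw [ha_one] at h2
  have h4 : K' / t ≤ 1 / 4 := by rw [div_le_iff₀ ht0]; linarith
  have h5 : 1 / 4 ≤ ∫ s in δ..t, volterraKernel a b c d t s := by linarith
  have h6 : f t ≤ f (t - δ) := hf.le_of_le (by linarith) (by linarith)
  have h7 := mul_le_mul_of_nonneg_left h5 (sub_nonneg.2 h6)
  have h8 : f t * (1 - ∫ s in (0 : ℝ)..t, volterraKernel a b c d t s) ≤ f t * (K' / t) :=
    mul_le_mul_of_nonneg_left (by linarith) (hf.nonneg t)
  rw [mul_add, mul_one, mul_div_assoc]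
  linarith

theorem renewalDefect_eq_of_volterra (hf : DecreasingProfile f) {a b r : ℝ → ℝ}
    {c : ℝ → ℝ → ℝ} {d t : ℝ} (ht : 0 < t)
    (ha : IntegrableOn a (Ioi 0)) (hb : IntegrableOn b (Ioi 0))
    (hc : IntegrableOn (c t) (Icc 0 t))
    (heq : f t = (∫ s in (0 : ℝ)..t, volterraKernel a b c d t s * f (t - s)) + r t) :
    renewalDefect a f t = (∫ s in Ioi (0 : ℝ), b s * f (t - s)) / (t + d) +
      ((∫ s in (0 : ℝ)..t, c t s * f (t - s)) + r t) := by
  have hii : ∀ q : ℝ → ℝ, IntegrableOn q (Ioc 0 t) →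
      IntervalIntegrable (fun s => q s * f (t - s)) volume 0 t := fun q hq => by
    rw [intervalIntegrable_iff_integrableOn_Ioc_of_le ht.le]
    exact hf.integrable_mul_comp_sub hq t
  have h1 := hii a (ha.mono_set Ioc_subset_Ioi_self)
  have h2 := (hii b (hb.mono_set Ioc_subset_Ioi_self)).div_const (t + d)
  have h3 := hii (c t) (hc.mono_set Ioc_subset_Icc_self)
  have h4 : ∀ s, volterraKernel a b c d t s * f (t - s) =
      a s * f (t - s) + b s * f (t - s) / (t + d) + c t s * f (t - s) := fun s => by
    rw [volterraKernel]; ring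
  simp only [h4] at heq
  rw [intervalIntegral.integral_add (h1.add h2) h3, intervalIntegral.integral_add h1 h2,
    intervalIntegral.integral_div, hf.integral_mul_comp_sub_eq a ht.le,
    hf.integral_mul_comp_sub_eq b ht.le] at heq
  rw [renewalDefect]
  linarith

/-- The errors come from moving `b` past the shift, from 1/(t+d) versus 1/t, and from `c` and `r`.
For the last two, split e^{-ηt} into two halves: one is O(f(t)), the other O(t⁻²). -/
theorem abs_renewalDefect_sub_le (hf : DecreasingProfile f) (hs : SlowlyVaryingUnderShifts f)
    {a b r : ℝ → ℝ} {c : ℝ → ℝ → ℝ} {d η Kc Kr : ℝ} (hd : 0 < d) (hη : 0 < η)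
    (hKc : 0 ≤ Kc) (hKr : 0 ≤ Kr)
    (ha : IntegrableOn a (Ioi 0)) (hb : IntegrableOn b (Ioi 0))
    (hbe : IntegrableOn (fun s => |b s| * Real.exp (η * s)) (Ioi 0))
    (hc_int : ∀ t : ℝ, 0 < t → IntegrableOn (c t) (Icc 0 t))
    (hc : ∀ t : ℝ, 0 ≤ t → ∫ s in (0 : ℝ)..t, |c t s| ≤ Kc * Real.exp (-(η * t)))
    (hr0 : ∀ t : ℝ, 0 ≤ t → 0 ≤ r t)
    (hr : ∀ t : ℝ, 0 ≤ t → r t ≤ Kr * Real.exp (-(η * t)))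
    (heq : ∀ t : ℝ, 0 < t →
      f t = (∫ s in (0 : ℝ)..t, volterraKernel a b c d t s * f (t - s)) + r t) :
    ∃ K T : ℝ, 0 ≤ K ∧ ∀ t, T ≤ t →
      |renewalDefect a f t - (∫ s in Ioi (0 : ℝ), b s) * (f t / t)| ≤ K * (f t / t ^ 2) := by
  obtain ⟨Kb, Tb, hKb, hTb, hconv⟩ := hf.abs_integral_mul_comp_sub_sub_le hs hη hb hbe
  have hη2 : 0 < η / 2 := by positivity
  obtain ⟨Ke, Te, hKe, hTe, hexp⟩ := hf.exp_neg_le hs hη2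
  set B := ∫ s in Ioi (0 : ℝ), b s
  refine ⟨Kb + |B| * d + (Kc + Kr) * (Ke * (2 / (η / 2) ^ 2)), max Tb Te, by positivity,
    fun t ht => ?_⟩
  have htb : Tb ≤ t := (le_max_left _ _).trans ht
  have hte : Te ≤ t := (le_max_right _ _).trans ht
  have ht0 : 0 < t := hTb.trans_le htb
  have htd : 0 < t + d := by linarith
  have hft := hf.nonneg t
  rw [hf.renewalDefect_eq_of_volterra ht0 ha hb (hc_int t ht0) (heq t ht0)]
  set X := ∫ s in Ioi (0 : ℝ), b s * f (t - s) with hX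
  set Y := ∫ s in (0 : ℝ)..t, c t s * f (t - s) with hY
  have b1 : |(X - B * f t) / (t + d)| ≤ Kb * (f t / t ^ 2) := by
    rw [abs_div, abs_of_pos htd]
    calc |X - B * f t| / (t + d) ≤ Kb * (f t / t) / t := by
          gcongr
          · exact hconv t htb
          · linarith
      _ = _ := by ring
  have b2 : |B * f t * (1 / t - 1 / (t + d))| ≤ |B| * d * (f t / t ^ 2) := by
    have h1 : 0 ≤ 1 / t - 1 / (t + d) := sub_nonneg.2 (by gcongr; linarith)
    have h2 : 1 / t - 1 / (t + d) ≤ d / t ^ 2 := by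
      rw [div_sub_div _ _ ht0.ne' htd.ne', div_le_div_iff₀ (by positivity) (by positivity)]
      nlinarith [mul_pos (mul_pos hd hd) ht0]
    rw [abs_mul, abs_mul, abs_of_nonneg hft, abs_of_nonneg h1]
    calc |B| * f t * (1 / t - 1 / (t + d)) ≤ |B| * f t * (d / t ^ 2) := by gcongr
      _ = _ := by ring
  have hE : Real.exp (-(η * t)) ≤ Ke * (2 / (η / 2) ^ 2) * (f t / t ^ 2) := by
    have h1 : Real.exp (-(η * t)) = Real.exp (-(η / 2 * t)) * Real.exp (-(η / 2 * t)) := by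
      rw [← Real.exp_add]; ring_nf
    rw [h1]
    calc _ ≤ Ke * f t * (2 / (η / 2) ^ 2 / t ^ 2) := by
          gcongr
          · exact hexp t hte
          · exact exp_neg_le_div_sq hη2 ht0
      _ = _ := by ring
  have b3 : |Y| ≤ Kc * Real.exp (-(η * t)) := by
    refine le_trans ?_ (hc t ht0.le)
    rw [← Real.norm_eq_abs, hY]
    refine intervalIntegral.norm_integral_le_of_norm_le ht0.le ?_ ?_
    · refine Eventually.of_forall fun s _ => ?_
      rw [norm_mul, Real.norm_eq_abs]
      exact mul_le_of_le_one_right (abs_nonneg _) (hf.norm_le_one _)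
    · rw [intervalIntegrable_iff_integrableOn_Ioc_of_le ht0.le]
      exact ((hc_int t ht0).mono_set Ioc_subset_Icc_self).abs
  have b4 : |r t| ≤ Kr * Real.exp (-(η * t)) := by
    rw [abs_of_nonneg (hr0 t ht0.le)]; exact hr t ht0.le
  have b5 := mul_le_mul_of_nonneg_left hE (add_nonneg hKc hKr)
  have e : X / (t + d) + (Y + r t) - B * (f t / t) =
      (X - B * f t) / (t + d) - B * f t * (1 / t - 1 / (t + d)) + Y + r t := by
    ring
  rw [e]
  rw [abs_le] at b1 b2 b3 b4 ⊢
  constructor <;> linarith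

end DecreasingProfile

theorem theorem3
    (a b r g : ℝ → ℝ) (c : ℝ → ℝ → ℝ) (d z γ : ℝ)
    -- `a` is a probability density on the positive half-line
    (ha_int : MeasureTheory.IntegrableOn a (Set.Ioi 0))
    (ha_nonneg : ∀ᵐ s ∂(MeasureTheory.volume.restrict (Set.Ioi (0 : ℝ))), 0 ≤ a s)
    (ha_one : ∫ s in Set.Ioi (0 : ℝ), a s = 1)
    -- `b` is integrable and `d` is positive
    (hb_int : MeasureTheory.IntegrableOn b (Set.Ioi 0))
    (hd : 0 < d)
    -- `r` is integrable, nonnegative and continuous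
    (hr_int : MeasureTheory.IntegrableOn r (Set.Ioi 0))
    (hr_nonneg : ∀ t : ℝ, 0 ≤ t → 0 ≤ r t)
    (hr_cont : ContinuousOn r (Set.Ici 0))
    -- `c` is jointly (Lebesgue) measurable, integrable in `s`, and vanishes as `t → ∞`
    (hc_meas : AEMeasurable (fun p : ℝ × ℝ => c p.1 p.2)
      (MeasureTheory.volume.restrict (Set.Ici (0 : ℝ) ×ˢ Set.Ici (0 : ℝ))))
    (hc_int : ∀ t : ℝ, 0 < t → MeasureTheory.IntegrableOn (c t) (Set.Icc 0 t))
    (hc_lim : ∀ᵐ s ∂(MeasureTheory.volume.restrict (Set.Ioi (0 : ℝ))),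
      Filter.Tendsto (fun t => c t s) Filter.atTop (nhds 0))
    -- exponential decay conditions
    (hz : 1 < z)
    (ha_exp : MeasureTheory.IntegrableOn (fun t => a t * z ^ t) (Set.Ioi 0))
    (hb_exp : MeasureTheory.IntegrableOn (fun t => |b t| * z ^ t) (Set.Ioi 0))
    (hc_dri : DirectlyRiemannIntegrable (fun t => z ^ t * ∫ s in (0 : ℝ)..t, |c t s|))
    (hr_dri : DirectlyRiemannIntegrable (fun t => r t * z ^ t))
    -- the kernel is nonnegative
    (hw : ∀ t : ℝ, 0 < t → ∀ᵐ s ∂(MeasureTheory.volume.restrict (Set.Icc 0 t)),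
      0 ≤ volterraKernel a b c d t s)
    -- `g` solves the integral equation
    (hg_zero : g 0 = 1)
    (hg_eq : ∀ t : ℝ, 0 < t →
      g t = (∫ s in (0 : ℝ)..t, volterraKernel a b c d t s * g (t - s)) + r t)
    -- `g` is positive at arbitrarily large arguments, and decreasing
    (hg_pos : ∀ T : ℝ, 0 < T → ∃ t : ℝ, T < t ∧ 0 < g t)
    (hg_anti : AntitoneOn g (Set.Ici 0))
    (hγ : γ = (∫ s in Set.Ioi (0 : ℝ), b s) / ∫ s in Set.Ioi (0 : ℝ), s * a s) :
    ∃ C : ℝ, 0 < C ∧ Filter.Tendsto (fun t => g t * t ^ (-γ)) Filter.atTop (nhds C) := by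
  set η := Real.log z with hη_def
  have hη : 0 < η := Real.log_pos hz
  have hz0 : 0 < z := by linarith
  obtain ⟨Kc, hKc, hc⟩ := hc_dri.exists_le_exp_neg hz fun _ _ => rfl
  obtain ⟨Kr, hKr, hr⟩ := hr_dri.exists_le_exp_neg hz fun _ _ => mul_comm _ _
  have hae : IntegrableOn (fun s => |a s| * Real.exp (η * s)) (Ioi 0) := by
    refine ha_exp.abs.congr (Eventually.of_forall fun s => ?_)
    simp only [abs_mul, Real.rpow_def_of_pos hz0, Real.abs_exp, hη_def]
  have hbe : IntegrableOn (fun s => |b s| * Real.exp (η * s)) (Ioi 0) := by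
    simpa only [Real.rpow_def_of_pos hz0] using hb_exp
  have hid : IntegrableOn (fun s => s * a s) (Ioi 0) := by
    simpa only [mul_comm] using integrableOn_mul_id_of_exp hη ha_int hae
  -- The zero extension lets the convolutions with `a` and `b` run over the whole half-line.
  set f := (Ici (0 : ℝ)).indicator g with hf_def
  have hf : DecreasingProfile f := decreasingProfile_indicator hg_zero hg_pos hg_anti
  have hfg : ∀ t, 0 ≤ t → f t = g t := fun t ht => indicator_of_mem ht g
  have heq : ∀ t, 0 < t →
      f t = (∫ s in (0 : ℝ)..t, volterraKernel a b c d t s * f (t - s)) + r t := by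
    intro t ht
    rw [hfg t ht.le, hg_eq t ht]
    congr 1
    refine intervalIntegral.integral_congr fun s hs => ?_
    rw [uIcc_of_le ht.le] at hs
    simp only [hfg (t - s) (by linarith [hs.2])]
  have hs : SlowlyVaryingUnderShifts f :=
    hf.slowlyVaryingUnderShifts hd hη hKc.le ha_int ha_one hb_int hae hc_int hc hw fun t ht => by
      linarith [heq t ht, hr_nonneg t ht.le]
  obtain ⟨K, T, hK, hdef⟩ := hf.abs_renewalDefect_sub_le hs hd hη hKc.le hKr.le ha_int hb_int hbe
    hc_int hc hr_nonneg hr heq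
  obtain ⟨C, hC, hlim⟩ := hf.exists_tendsto_mul_rpow hs hη ha_int ha_one hae
    (setIntegral_id_mul_pos hid ha_nonneg ha_one) hK hdef
  refine ⟨C, hC, hlim.congr' ?_⟩
  filter_upwards [eventually_ge_atTop 0] with t ht
  rw [hfg t ht, hγ]
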